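/- Let $P\subset\mathbb{R}^n$ be a convex $d$-polytope ($d\ge 0$), and let $\mathcal{C}_P$ be a pointed triangulation of $P$. That is, $\mathcal{C}_P$ is a finite simplicial complex with underlying space $P$, and each nonempty face $F$ of $P$ (including $P$ itself) has a triangulation $\mathcal{C}_F$, equal to $\mathcal{C}_P$ for $F=P$, and an apex $\mathbf{v}_F\in\mathrm{Vert}(F)$ such that (1) $\mathbf{v}_F$ lies in every simplex of $\mathcal{C}_F$ of dimension $\dim F$; (2) if $F_1,F_2$ are faces of $P$ with $\mathbf{v}_{F_1},\mathbf{v}_{F_2}\in F_1\cap F_2$, then $\mathbf{v}_{F_1}=\mathbf{v}_{F_2}$; (3) for each $F$ and each $\mathbf{w}\in\mathrm{Vert}(F)\setminus\{\mathbf{v}_F\}$, the edge $\mathrm{Conv}\{\mathbf{v}_F,\mathbf{w}\}$ is in $\mathcal{C}_F$. Let $f_{-1}=1$, let $f_i$ be the number of $i$-dimensional simplices of $\mathcal{C}_P$, and let the $h$-vector $(h_0,\dots,h_{d+1})$ of $\mathcal{C}_P$ be given by $$h_j=\sum_{i=0}^{j}(-1)^{j-i}\binom{d+1-i}{d+1-j}f_{i-1}.$$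 Let $\mathbf{x}\in P$ be in general position, i.e. in the affine hull of no simplex of $\mathcal{C}_P$ of dimension less than $d$. A facet of a $d$-simplex $F$ of $\mathcal{C}_P$ is visible from $\mathbf{x}$ if, for some point $\mathbf{y}$ of its relative interior, the segment from $\mathbf{x}$ to $\mathbf{y}$ does not meet $F$ before reaching $\mathbf{y}$. Let $G_F$ (respectively $D_F$) be the set of vertices of $F$ that are opposite a facet of $F$ visible (respectively not visible) from $\mathbf{x}$. The $k$-vector $(k_0,\dots,k_{d+1})$ of the interior complex (the simplices of $\mathcal{C}_P$ that lie in no proper face of $P$) is defined by letting $k_i$ be the number of $d$-simplices $F$ of $\mathcal{C}_P$ with $|D_F|=i$. Then $|D_F|+|G_F|=d+1$ for every $d$-simplex $F$ of $\mathcal{C}_P$, and the $k$-vector is the reverse of the $h$-vector: $k_i=h_{d+1-i}$ for all $0\le i\le d+1$. -/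

import Mathlib

section PointedTriangulations

variable {E : Type*} [NormedAddCommGroup E] [NormedSpace ℝ E]

/-- `P` is a (nonempty) convex polytope of dimension `d`: the convex hull of finitely many points,
whose affine hull has dimension `d`. -/
def IsPolytope (d : ℕ) (P : Set E) : Prop :=
  (∃ V : Finset E, V.Nonempty ∧ P = convexHull ℝ (V : Set E)) ∧
    Module.finrank ℝ (vectorSpan ℝ P) = d

/-- `F` is a nonempty face of the polytope `P` (the polytope `P` itself is one of them): the set of
points of `P` at which some linear functional attains its maximum over `P`. -/
def IsFace (P F : Set E) : Prop :=
  F.Nonempty ∧ IsExposed ℝ P F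

/-- `K` is a triangulation of `P`: a finite simplicial complex with underlying space `P`.
A simplex of `K` is given by the finite set of its vertices (affinely independent points), so that
a `k`-simplex is a set of `k + 1` points. -/
def IsTriangulation (K : Geometry.SimplicialComplex ℝ E) (P : Set E) : Prop :=
  K.faces.Finite ∧ K.space = P

/-- `K` is a pointed triangulation of the polytope `P`. Here `C F` is the triangulation of the
face `F` (so that `C P` is `K`) and `v F` is the apex of `F`. -/
def IsPointedTriangulation (K : Geometry.SimplicialComplex ℝ E) (P : Set E) : Prop :=
  ∃ (C : Set E → Geometry.SimplicialComplex ℝ E) (v : Set E → E),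
    C P = K ∧
    (∀ F, IsFace P F → IsTriangulation (C F) F) ∧
    (∀ F, IsFace P F → v F ∈ F.extremePoints ℝ) ∧
    (∀ F, IsFace P F → ∀ S ∈ (C F).faces,
      S.card = Module.finrank ℝ (vectorSpan ℝ F) + 1 → v F ∈ convexHull ℝ (S : Set E)) ∧
    (∀ F₁ F₂, IsFace P F₁ → IsFace P F₂ →
      v F₁ ∈ F₁ ∩ F₂ → v F₂ ∈ F₁ ∩ F₂ → v F₁ = v F₂) ∧
    (∀ F, IsFace P F → ∀ w ∈ F.extremePoints ℝ, w ≠ v F →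
      ∃ S ∈ (C F).faces, (S : Set E) = {v F, w})

/-- The `d`-dimensional simplices of `K`. -/
def topSimplices (K : Geometry.SimplicialComplex ℝ E) (d : ℕ) : Set (Finset E) :=
  {S | S ∈ K.faces ∧ S.card = d + 1}

/-- The number of simplices of `K` with exactly `i` vertices, where the empty simplex counts as a
simplex of `K` (Mathlib leaves it out of `K.faces`). This is the component `f_{i-1}` of the
`f`-vector of `K`; in particular its value at `i = 0` is `f_{-1} = 1`. -/
noncomputable def faceCount (K : Geometry.SimplicialComplex ℝ E) (i : ℕ) : ℕ :=
  {S : Finset E | (S = ∅ ∨ S ∈ K.faces) ∧ S.card = i}.ncard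

/-- The component `h_j`, for `0 ≤ j ≤ d + 1`, of the `h`-vector of the `d`-dimensional simplicial
complex `K`: `h_j = ∑_{i=0}^{j} (-1)^{j-i} (d+1-i choose d+1-j) f_{i-1}`. -/
noncomputable def hVec (K : Geometry.SimplicialComplex ℝ E) (d j : ℕ) : ℤ :=
  ∑ i ∈ Finset.range (j + 1),
    (-1) ^ (j - i) * ((d + 1 - i).choose (d + 1 - j) : ℤ) * (faceCount K i : ℤ)

/-- `x` is a point of `P` in general position with respect to the triangulation `K` of the
`d`-polytope `P`: it lies in the affine hull of no simplex of `K` of dimension less than `d`. -/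
def IsInGeneralPosition (K : Geometry.SimplicialComplex ℝ E) (d : ℕ) (P : Set E) (x : E) : Prop :=
  x ∈ P ∧ ∀ S ∈ K.faces, S.card < d + 1 → x ∉ affineSpan ℝ (S : Set E)

/-- The facet `T` of the simplex `S` is visible from `x`: for some point `y` of the relative interior
of `T`, the segment from `x` to `y` does not meet `S` before reaching `y`. -/
def IsVisibleFacet (x : E) (S T : Finset E) : Prop :=
  ∃ y ∈ intrinsicInterior ℝ (convexHull ℝ (T : Set E)),
    IsVisible ℝ (convexHull ℝ (S : Set E)) x y

/-- The facets of the simplex `S`. -/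
def simplexFacets (S : Finset E) : Set (Finset E) :=
  {T | T ⊆ S ∧ T.card + 1 = S.card}

/-- `R_F`: the facets of the simplex `F` that are visible from `x`. -/
def visibleFacets (x : E) (F : Finset E) : Set (Finset E) :=
  {T | T ∈ simplexFacets F ∧ IsVisibleFacet x F T}

/-- `Q_F`: the facets of the simplex `F` that are not visible from `x`. -/
def nonvisibleFacets (x : E) (F : Finset E) : Set (Finset E) :=
  simplexFacets F \ visibleFacets x F

open Classical in
/-- `G_F`: the vertices of the simplex `F` that are opposite a facet visible from `x`. -/
noncomputable def visibleOpp (x : E) (F : Finset E) : Finset E :=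
  {u ∈ F | F.erase u ∈ visibleFacets x F}

open Classical in
/-- `D_F`: the vertices of the simplex `F` that are opposite a facet not visible from `x`. -/
noncomputable def nonvisibleOpp (x : E) (F : Finset E) : Finset E :=
  {u ∈ F | F.erase u ∈ nonvisibleFacets x F}

/-- The component `k_i` of the `k`-vector, formed with respect to `x`, of the interior complex of
the triangulation `K` of a `d`-polytope: the number of `d`-simplices `F` of `K` with
`|D_F| = i`. -/
noncomputable def kVec (K : Geometry.SimplicialComplex ℝ E) (d : ℕ) (x : E) (i : ℕ) : ℕ :=
  {F ∈ topSimplices K d | (nonvisibleOpp x F).card = i}.ncard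

end PointedTriangulations

/-!
A generic point `x` of the polytope induces a half-open decomposition of the triangulated space:
delete from each top-dimensional simplex `F` its facets that are visible from `x`. A face `T` of
`F` survives exactly when it contains the set `visibleOpp x F` of vertices opposite the visible
facets. Every simplex `T` of the triangulation, the empty one included, survives in exactly one `F`
(`existsUnique_visibleOpp_subset`): start at a point `y` in the relative interior of `T` and move a
little towards `x`. Convexity keeps the path in the polytope, general position puts it in the
interior of a single top-dimensional simplex `F`, and the sign of the barycentric coordinates of `x`
with respect to `F` decides which simplex that is. The empty simplex survives in the
simplex that contains `x`.

That sign also decides visibility: the facet opposite `u` is visible exactly when the coordinate of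
`x` at `u` is negative (`IsBaryCoord.mem_visibleFacets_iff`). Hence the number of simplices with `i`
vertices is the sum over `F` of the numbers of `i`-element sets between `visibleOpp x F` and `F`
(`faceCount_eq_sum`). Applying the `h`-vector transform to one such summand gives a unit vector
(`sum_alternating_choose_eq_ite`), so `h_j` is the number of top-dimensional simplices with `j`
visible facets (`hVec_eq_card`). These have `d + 1 - j` nonvisible facets, whence the claim.
-/

open Finset Filter Topology

variable {E : Type*} [NormedAddCommGroup E] [NormedSpace ℝ E]

/-! ### Barycentric coordinates -/

/-- `c` is a system of barycentric coordinates for the simplex with vertex set `S`: the coordinate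
`c u` at the vertex `u ∈ S` is an affine function on the whole ambient space that is `1` at `u` and
`0` at the other vertices. Outside `affineSpan ℝ S` the values of `c u` depend on the choice
of `c`. -/
def IsBaryCoord (S : Finset E) (c : E → E →ᵃ[ℝ] ℝ) : Prop :=
  ∀ u ∈ S, c u u = 1 ∧ ∀ w ∈ S, w ≠ u → c u w = 0

/-- Coordinates exist: extend the vertices of the simplex to an affine basis of the space. -/
theorem exists_isBaryCoord {S : Finset E} (hS : AffineIndependent ℝ ((↑) : S → E)) :
    ∃ c, IsBaryCoord S c := by
  classical
  obtain ⟨t, hSt, hind, htop⟩ :=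
    exists_subset_affineIndependent_affineSpan_eq_top (k := ℝ) (s := (S : Set E)) hS
  let b : AffineBasis t ℝ E := ⟨(↑), hind, by simpa using htop⟩
  refine ⟨fun u => if h : u ∈ t then b.coord ⟨u, h⟩ else 0, fun u hu => ?_⟩
  have hut : u ∈ t := hSt hu
  simp only [hut, dite_true]
  refine ⟨b.coord_apply_eq ⟨u, hut⟩, fun w hw hwu => ?_⟩
  exact b.coord_apply_ne (i := ⟨u, hut⟩) (j := ⟨w, hSt hw⟩)
    fun h => hwu (congrArg Subtype.val h).symm

theorem AffineMap.lineMap_real_apply (f : E →ᵃ[ℝ] ℝ) (y x : E) (t : ℝ) :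
    f (AffineMap.lineMap y x t) = (1 - t) * f y + t * f x := by
  rw [AffineMap.apply_lineMap, AffineMap.lineMap_apply_module]
  simp

namespace IsBaryCoord

variable {S T : Finset E} {c : E → E →ᵃ[ℝ] ℝ}

theorem sum_eq (hc : IsBaryCoord S c) {p : E} (hp : p ∈ affineSpan ℝ (S : Set E)) :
    ∑ u ∈ S, c u p = 1 ∧ ∑ u ∈ S, c u p • u = p := by
  refine affineSpan_induction (p := fun p => ∑ u ∈ S, c u p = 1 ∧ ∑ u ∈ S, c u p • u = p) hp ?_ ?_
  · intro p hp
    have hp' : p ∈ S := hp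
    have h : ∀ u ∈ S, u ≠ p → c u p = 0 := fun u hu hup => (hc u hu).2 p hp' hup.symm
    rw [Finset.sum_eq_single_of_mem p hp' h,
      Finset.sum_eq_single_of_mem p hp' fun u hu hup => by rw [h u hu hup, zero_smul]]
    simp [(hc p hp').1]
  · intro a p q r hp hq hr
    have h : ∀ u, c u (a • (p -ᵥ q) +ᵥ r) = a * (c u p - c u q) + c u r := fun u => by
      rw [AffineMap.map_vadd, map_smul, AffineMap.linearMap_vsub]
      simp
    simp only [h, add_smul, mul_smul, sub_smul, Finset.sum_add_distrib, ← Finset.mul_sum,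
      ← Finset.smul_sum, Finset.sum_sub_distrib, hp, hq, hr]
    simp

theorem nonneg (hc : IsBaryCoord S c) {p : E} (hp : p ∈ convexHull ℝ (S : Set E)) {u : E}
    (hu : u ∈ S) : 0 ≤ c u p := by
  refine convexHull_min (t := c u ⁻¹' Set.Ici 0) (fun w hw => ?_)
    ((convex_Ici 0).affine_preimage (c u)) hp
  by_cases h : w = u
  · simp [h, (hc u hu).1]
  · simp [(hc u hu).2 w hw h]

/-- The coordinate at a vertex vanishes on every face that misses the vertex. -/
theorem eq_zero (hc : IsBaryCoord S c) (hTS : T ⊆ S) {p : E}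
    (hp : p ∈ convexHull ℝ (T : Set E)) {u : E} (hu : u ∈ S) (huT : u ∉ T) : c u p = 0 := by
  refine convexHull_min (t := c u ⁻¹' {0}) (fun w hw => ?_)
    ((convex_singleton (0 : ℝ)).affine_preimage (c u)) hp
  exact (hc u hu).2 w (hTS hw) (by rintro rfl; exact huT hw)

/-- The coordinates attached to a simplex restrict to coordinates of its faces. -/
theorem mono (hc : IsBaryCoord S c) (hTS : T ⊆ S) : IsBaryCoord T c :=
  fun u hu => ⟨(hc u (hTS hu)).1, fun w hw => (hc u (hTS hu)).2 w (hTS hw)⟩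

theorem mem_convexHull (hc : IsBaryCoord S c) {p : E} (hp : p ∈ affineSpan ℝ (S : Set E))
    (h : ∀ u ∈ S, 0 ≤ c u p) : p ∈ convexHull ℝ (S : Set E) :=
  Finset.mem_convexHull'.2 ⟨fun u => c u p, h, (hc.sum_eq hp).1, (hc.sum_eq hp).2⟩

/-- A point whose coordinate at `u` vanishes lies in the affine span of the facet opposite `u`. -/
theorem mem_affineSpan_erase [DecidableEq E] (hc : IsBaryCoord S c) {p : E}
    (hp : p ∈ affineSpan ℝ (S : Set E)) {u : E} (hu : u ∈ S) (h : c u p = 0) :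
    p ∈ affineSpan ℝ (S.erase u : Set E) := by
  obtain ⟨h1, h2⟩ := hc.sum_eq hp
  rw [← Finset.add_sum_erase S _ hu, h, zero_add] at h1
  rw [← Finset.add_sum_erase S _ hu, h, zero_smul, zero_add] at h2
  have := affineCombination_mem_affineSpan (k := ℝ) (s := (S.erase u).attach)
    (w := fun w => c w p) (by rwa [Finset.sum_attach (S.erase u) fun w => c w p])
    ((↑) : S.erase u → E)
  rw [Finset.affineCombination_eq_linear_combination _ _ _
    (by rwa [Finset.sum_attach (S.erase u) fun w => c w p]),
    Finset.sum_attach (S.erase u) fun w => c w p • w, h2] at this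
  rwa [Subtype.range_coe] at this

/-- All coordinates are positive at a point of the relative interior: the segment from a vertex to
the point can be prolonged a little within the simplex. -/
theorem pos_of_mem_intrinsicInterior (hc : IsBaryCoord S c) {p : E}
    (hp : p ∈ intrinsicInterior ℝ (convexHull ℝ (S : Set E))) {u : E} (hu : u ∈ S) :
    0 < c u p := by
  refine (hc.nonneg (intrinsicInterior_subset hp) hu).lt_of_ne fun h0 => ?_
  obtain ⟨q, hq, rfl⟩ := mem_intrinsicInterior.1 hp
  have hu' : u ∈ affineSpan ℝ (convexHull ℝ (S : Set E)) :=
    subset_affineSpan _ _ (subset_convexHull ℝ _ hu)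
  let g : ℝ → affineSpan ℝ (convexHull ℝ (S : Set E)) :=
    fun t => ⟨AffineMap.lineMap u (q : E) t, AffineMap.lineMap_mem t hu' q.2⟩
  have hg : Continuous g := by
    refine Continuous.subtype_mk ?_ _
    exact AffineMap.lineMap_continuous
  have hg1 : g 1 = q := by ext; simp [g]
  have hev : ∀ᶠ t in 𝓝[>] (1 : ℝ), g t ∈ interior ((↑) ⁻¹' convexHull ℝ (S : Set E)) :=
    (hg.continuousAt.eventually_mem (isOpen_interior.mem_nhds (by rwa [hg1]))).filter_mono
      nhdsWithin_le_nhds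
  obtain ⟨t, ht, ht1⟩ := (hev.and self_mem_nhdsWithin).exists
  have ht2 : (g t : E) ∈ convexHull ℝ (S : Set E) := Set.mem_preimage.1 (interior_subset ht)
  have h := hc.nonneg ht2 hu
  have ht1' : (1 : ℝ) < t := ht1
  simp only [g, AffineMap.lineMap_real_apply, ← h0, (hc u hu).1] at h
  linarith

/-- A facet of a simplex is visible from a point `x` of the affine span off the hyperplane of the
facet exactly when the coordinate of `x` at the opposite vertex is negative. -/
theorem mem_visibleFacets_iff [FiniteDimensional ℝ E] [DecidableEq E] (hc : IsBaryCoord S c)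
    {x : E} (hx : x ∈ affineSpan ℝ (S : Set E)) {u : E} (hu : u ∈ S) (h0 : c u x ≠ 0) :
    S.erase u ∈ visibleFacets x S ↔ c u x < 0 := by
  have hfacet : S.erase u ∈ simplexFacets S :=
    ⟨Finset.erase_subset u S, Finset.card_erase_add_one hu⟩
  have hface : ∀ y ∈ intrinsicInterior ℝ (convexHull ℝ (S.erase u : Set E)), c u y = 0 :=
    fun y hy => hc.eq_zero (Finset.erase_subset u S)
      (by simpa using intrinsicInterior_subset hy) hu (Finset.notMem_erase u S)
  constructor
  · rintro ⟨-, y, hy, hvis⟩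
    rw [Finset.coe_erase] at hy
    have hy0 : c u y = 0 := hface y (by simpa using hy)
    by_contra hneg
    have hpos : 0 < c u x := (not_lt.1 hneg).lt_of_ne h0.symm
    -- Just before reaching `y`, all coordinates are nonnegative, so the simplex blocks the view.
    have hev : ∀ᶠ t in 𝓝[>] (0 : ℝ), ∀ w ∈ S, 0 ≤ c w (AffineMap.lineMap y x t) := by
      rw [Filter.eventually_all_finset]
      intro w hw
      by_cases hwu : w = u
      · subst hwu
        filter_upwards [self_mem_nhdsWithin] with t ht
        rw [AffineMap.lineMap_real_apply, hy0]
        have ht' : (0 : ℝ) < t := ht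
        simpa using (mul_pos ht' hpos).le
      · have hwy : 0 < c w y := (hc.mono (Finset.erase_subset u S)).pos_of_mem_intrinsicInterior
          (by simpa using hy) (Finset.mem_erase.2 ⟨hwu, hw⟩)
        simp only [AffineMap.lineMap_real_apply]
        have hcont : Continuous fun t : ℝ => (1 - t) * c w y + t * c w x := by fun_prop
        have := hcont.continuousAt.eventually_mem (x := 0)
          (s := Set.Ioi 0) (isOpen_Ioi.mem_nhds (by simpa using hwy))
        filter_upwards [this.filter_mono nhdsWithin_le_nhds] with t ht using le_of_lt ht
    obtain ⟨t, ⟨ht, ht0⟩, ht1⟩ := ((hev.and self_mem_nhdsWithin).and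
      (nhdsWithin_le_nhds (Iio_mem_nhds (zero_lt_one' ℝ)))).exists
    have hyS : y ∈ affineSpan ℝ (S : Set E) := convexHull_subset_affineSpan _
      (convexHull_mono (by simp) (intrinsicInterior_subset hy))
    refine hvis (hc.mem_convexHull (AffineMap.lineMap_mem t hyS hx) ht) (sbtw_comm.1 ?_)
    exact sbtw_lineMap_iff.2 ⟨fun h => h0 (h ▸ hy0), ht0, ht1⟩
  · intro hneg
    -- The only coordinate on a `0`-simplex is `1`, so a negative one makes the facet nonempty.
    have hne : (S.erase u).Nonempty := by
      by_contra h
      have hS : S = {u} := by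
        rw [← Finset.insert_erase hu, Finset.not_nonempty_iff_eq_empty.1 h]
        rfl
      have := (hc.sum_eq hx).1
      rw [hS, Finset.sum_singleton] at this
      linarith
    obtain ⟨y, hy⟩ := (convexHull_nonempty_iff.2 (Finset.coe_nonempty.2 hne)).intrinsicInterior
      (convex_convexHull ℝ _)
    refine ⟨hfacet, y, hy, fun z hz hb => ?_⟩
    obtain ⟨-, t, ⟨ht0, ht1⟩, rfl⟩ := sbtw_iff_mem_image_Ioo_and_ne.1 (sbtw_comm.1 hb) |>.symm
    have := hc.nonneg hz hu
    rw [AffineMap.lineMap_real_apply, hface y (by simpa using hy)] at this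
    nlinarith

end IsBaryCoord

/-! ### Counting lemmas -/

theorem card_filter_subset_powersetCard {α : Type*} [DecidableEq α] {G F : Finset α} (h : G ⊆ F)
    (i : ℕ) : #{T ∈ F.powersetCard i | G ⊆ T} =
      if #G ≤ i then (#F - #G).choose (i - #G) else 0 := by
  split_ifs with hi
  · rw [← card_sdiff_of_subset h, ← card_powersetCard]
    refine (card_bij' (fun T _ => T ∪ G) (fun T _ => T \ G) ?_ ?_ ?_ ?_).symm
    · intro T hT
      obtain ⟨hT1, hT2⟩ := mem_powersetCard.1 hT
      have hd : Disjoint T G := disjoint_of_subset_left hT1 sdiff_disjoint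
      refine mem_filter.2 ⟨mem_powersetCard.2
        ⟨union_subset (hT1.trans sdiff_subset) h, ?_⟩, subset_union_right⟩
      rw [card_union_of_disjoint hd]
      omega
    · intro T hT
      obtain ⟨hT1, hG⟩ := mem_filter.1 hT
      obtain ⟨hT1, hT2⟩ := mem_powersetCard.1 hT1
      exact mem_powersetCard.2 ⟨sdiff_subset_sdiff hT1 le_rfl, by
        rw [card_sdiff_of_subset hG, hT2]⟩
    · intro T hT
      have hd : Disjoint T G :=
        disjoint_of_subset_left (mem_powersetCard.1 hT).1 sdiff_disjoint
      exact union_sdiff_cancel_right hd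
    · intro T hT
      exact sdiff_union_of_subset (mem_filter.1 hT).2
  · rw [card_eq_zero, filter_eq_empty_iff]
    intro T hT hG
    exact hi ((card_le_card hG).trans (mem_powersetCard.1 hT).2.le)

/-- The `h`-vector transform, applied to the numbers of `i`-element sets between a fixed `g`-element
set and a fixed `D`-element set, gives the unit vector at `g`. -/
theorem sum_alternating_choose_eq_ite {D g j : ℕ} (hj : j ≤ D) :
    ∑ i ∈ range (j + 1), (-1) ^ (j - i) * ((D - i).choose (D - j) : ℤ) *
      ((if g ≤ i then (D - g).choose (i - g) else 0 : ℕ) : ℤ) = if g = j then 1 else 0 := by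
  rcases lt_or_ge j g with hjg | hgj
  · rw [if_neg hjg.ne', sum_eq_zero]
    intro i hi
    rw [if_neg (by have := mem_range.1 hi; omega), Nat.cast_zero, mul_zero]
  obtain ⟨m, rfl⟩ := Nat.exists_eq_add_of_le hgj
  obtain ⟨N, rfl⟩ := Nat.exists_eq_add_of_le (hgj.trans hj)
  have hmN : m ≤ N := by omega
  rw [add_assoc, sum_range_add, sum_eq_zero fun i hi => by
    rw [if_neg (not_le.2 (mem_range.1 hi)), Nat.cast_zero, mul_zero], zero_add]
  have hterm : ∀ k ∈ range (m + 1), (-1) ^ (g + m - (g + k)) *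
      ((g + N - (g + k)).choose (g + N - (g + m)) : ℤ) *
      ((if g ≤ g + k then (g + N - g).choose (g + k - g) else 0 : ℕ) : ℤ) =
      (-1) ^ m * (N.choose m : ℤ) * ((-1) ^ k * (m.choose k : ℤ)) := by
    intro k hk
    have hkm : k ≤ m := Nat.lt_succ_iff.1 (mem_range.1 hk)
    have h1 : (N - k).choose (N - m) = (N - k).choose (m - k) := by
      rw [← Nat.choose_symm (by omega : m - k ≤ N - k)]
      congr 1
      omega
    have h2 : (N.choose m : ℤ) * m.choose k = N.choose k * (N - k).choose (m - k) := by
      exact_mod_cast Nat.choose_mul (n := N) hkm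
    have h3 : (-1 : ℤ) ^ (m - k) = (-1) ^ m * (-1) ^ k := by
      obtain ⟨l, rfl⟩ := Nat.exists_eq_add_of_le hkm
      rw [Nat.add_sub_cancel_left, pow_add, mul_right_comm, ← mul_pow]
      simp
    rw [if_pos (by omega), Nat.add_sub_add_left, Nat.add_sub_add_left, Nat.add_sub_add_left,
      Nat.add_sub_cancel_left, Nat.add_sub_cancel_left, h1, h3]
    linear_combination -(-1) ^ m * (-1) ^ k * h2
  rw [sum_congr rfl hterm, ← mul_sum, Int.alternating_sum_range_choose]
  rcases Nat.eq_zero_or_pos m with rfl | hm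
  · simp
  · rw [if_neg hm.ne', if_neg (by omega), mul_zero]

/-! ### The half-open decomposition -/

theorem visibleOpp_subset (x : E) (F : Finset E) : visibleOpp x F ⊆ F := by
  classical
  exact Finset.filter_subset _ _

/-- Two top-dimensional simplices of `K` coincide if some point has only positive coordinates in
one of them and lies in the other. -/
theorem eq_of_coord_pos_of_mem {K : Geometry.SimplicialComplex ℝ E} {d : ℕ}
    {S S' : Finset E} (hS : S ∈ topSimplices K d)
    (hS' : S' ∈ topSimplices K d) {c : E → E →ᵃ[ℝ] ℝ} (hc : IsBaryCoord S c) {z : E}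
    (hz : z ∈ convexHull ℝ (S : Set E)) (hpos : ∀ u ∈ S, 0 < c u z)
    (hz' : z ∈ convexHull ℝ (S' : Set E)) : S = S' := by
  classical
  refine Finset.eq_of_subset_of_card_le (fun u hu => ?_) (by rw [hS.2, hS'.2])
  by_contra huS'
  have h := K.inter_subset_convexHull hS.1 hS'.1 ⟨hz, hz'⟩
  rw [← Finset.coe_inter] at h
  exact (hpos u hu).ne' (hc.eq_zero Finset.inter_subset_left h hu (by simp [huS']))

section Decomposition

variable [FiniteDimensional ℝ E] {K : Geometry.SimplicialComplex ℝ E} {P : Set E} {d : ℕ} {x : E}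

theorem card_le_of_mem_faces (hK : K.space = P) (hd : Module.finrank ℝ (vectorSpan ℝ P) = d)
    {S : Finset E} (hS : S ∈ K.faces) : S.card ≤ d + 1 := by
  have hSP : (S : Set E) ⊆ P := hK ▸ K.subset_space hS
  have h := (K.indep hS).card_le_finrank_succ
  rw [Subtype.range_coe_subtype, Fintype.card_coe] at h
  have h2 := Submodule.finrank_mono (vectorSpan_mono ℝ hSP)
  change S.card ≤ Module.finrank ℝ (vectorSpan ℝ (S : Set E)) + 1 at h
  omega

/-- A top-dimensional simplex spans the affine hull of the polytope. -/
theorem mem_affineSpan_of_mem_topSimplices (hK : K.space = P)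
    (hd : Module.finrank ℝ (vectorSpan ℝ P) = d) {S : Finset E} (hS : S ∈ topSimplices K d)
    {p : E} (hp : p ∈ P) : p ∈ affineSpan ℝ (S : Set E) := by
  have hSP : (S : Set E) ⊆ P := hK ▸ K.subset_space hS.1
  have hr : Set.range ((↑) : S → E) = (S : Set E) := Subtype.range_coe
  have h := (K.indep hS.1).affineSpan_eq_of_le_of_card_eq_finrank_add_one (sp := affineSpan ℝ P)
    (by rw [hr]; exact affineSpan_mono ℝ hSP)
    (by rw [Fintype.card_coe, hS.2, direction_affineSpan, hd])
  rw [hr] at h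
  exact h ▸ subset_affineSpan ℝ P hp

/-- General position: no coordinate of `x` vanishes. In dimension `0` the facet opposite the only
vertex is empty, so that it spans nothing. -/
theorem coord_ne_zero (hK : K.space = P) (hd : Module.finrank ℝ (vectorSpan ℝ P) = d)
    (hx : IsInGeneralPosition K d P x) {S : Finset E} (hS : S ∈ topSimplices K d)
    {c : E → E →ᵃ[ℝ] ℝ} (hc : IsBaryCoord S c) {u : E} (hu : u ∈ S) : c u x ≠ 0 := by
  classical
  intro h0
  have hxe := hc.mem_affineSpan_erase (mem_affineSpan_of_mem_topSimplices hK hd hS hx.1) hu h0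
  have hne : (S.erase u).Nonempty := by
    rw [← Finset.coe_nonempty, ← affineSpan_nonempty ℝ]
    exact ⟨x, hxe⟩
  refine hx.2 _ (K.down_closed hS.1 (Finset.erase_subset u S) hne) ?_ hxe
  have := Finset.card_erase_add_one hu
  have := hS.2
  omega

theorem mem_visibleOpp_iff (hK : K.space = P) (hd : Module.finrank ℝ (vectorSpan ℝ P) = d)
    (hx : IsInGeneralPosition K d P x) {S : Finset E} (hS : S ∈ topSimplices K d)
    {c : E → E →ᵃ[ℝ] ℝ} (hc : IsBaryCoord S c) {u : E} (hu : u ∈ S) :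
    u ∈ visibleOpp x S ↔ c u x < 0 := by
  classical
  rw [← hc.mem_visibleFacets_iff (mem_affineSpan_of_mem_topSimplices hK hd hS hx.1) hu
    (coord_ne_zero hK hd hx hS hc hu)]
  simp only [visibleOpp, Finset.mem_filter, hu, true_and]

/-- Every simplex `T` of `K` contains a point, in its relative interior, from which to start moving
towards `x`; the empty simplex is represented by `x` itself. -/
theorem exists_representing_point (hK : K.space = P) (hx : x ∈ P) {T : Finset E}
    (hT : T = ∅ ∨ T ∈ K.faces) :
    ∃ y ∈ P, (∀ S ∈ K.faces, y ∈ convexHull ℝ (S : Set E) → T ⊆ S) ∧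
      ∀ S c, IsBaryCoord S c → T ⊆ S →
        (∀ u ∈ T, 0 < c u y) ∧ ∀ u ∈ S, u ∉ T → c u y = 0 ∨ y = x := by
  classical
  rcases hT with rfl | hT
  · exact ⟨x, hx, fun _ _ _ => Finset.empty_subset _,
      fun _ _ _ _ => ⟨by simp, fun _ _ _ => Or.inr rfl⟩⟩
  obtain ⟨y, hy⟩ := (convexHull_nonempty_iff.2
    (Finset.coe_nonempty.2 (K.nonempty_of_mem_faces hT))).intrinsicInterior (convex_convexHull ℝ _)
  have hyT := intrinsicInterior_subset hy
  refine ⟨y, hK ▸ K.convexHull_subset_space hT hyT, fun S hS hyS u hu => ?_,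
    fun S c hc hTS => ⟨fun u hu => (hc.mono hTS).pos_of_mem_intrinsicInterior hy hu,
      fun u hu huT => Or.inl (hc.eq_zero hTS hyT hu huT)⟩⟩
  obtain ⟨c, hc⟩ := exists_isBaryCoord (K.indep hT)
  by_contra huS
  have h := K.inter_subset_convexHull hT hS ⟨hyT, hyS⟩
  rw [← Finset.coe_inter] at h
  have h0 := hc.eq_zero Finset.inter_subset_left h hu (by simp [huS])
  exact (hc.pos_of_mem_intrinsicInterior hy hu).ne' h0

/-- The half-open decomposition: removing from every top-dimensional simplex its facets visible
from `x` leaves disjoint pieces that cover everything, so each simplex `T` of `K` (the empty one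
included) is a face of exactly one top-dimensional simplex `F` without lying in one of its visible
facets. It is the simplex `F` into which one moves from `T` by going towards `x`. -/
theorem existsUnique_visibleOpp_subset (hfin : K.faces.Finite) (hK : K.space = P)
    (hconv : Convex ℝ P) (hd : Module.finrank ℝ (vectorSpan ℝ P) = d)
    (hx : IsInGeneralPosition K d P x) {T : Finset E} (hT : T = ∅ ∨ T ∈ K.faces) :
    ∃! F, F ∈ topSimplices K d ∧ visibleOpp x F ⊆ T ∧ T ⊆ F := by
  obtain ⟨y, hyP, hyS, hyc⟩ := exists_representing_point hK hx.1 hT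
  have hlt : ∀ᶠ t in 𝓝[>] (0 : ℝ), t < 1 := nhdsWithin_le_nhds (Iio_mem_nhds zero_lt_one)
  -- A simplex of the required kind contains the points of the path near its start in its interior.
  have hA : ∀ S ∈ topSimplices K d, visibleOpp x S ⊆ T → T ⊆ S → ∀ c, IsBaryCoord S c →
      ∀ᶠ t in 𝓝[>] (0 : ℝ), ∀ u ∈ S, 0 < c u (AffineMap.lineMap y x t) := by
    intro S hS hG hTS c hc
    rw [Filter.eventually_all_finset]
    intro u hu
    by_cases huT : u ∈ T
    · simp only [AffineMap.lineMap_real_apply]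
      have hcont : Continuous fun t : ℝ => (1 - t) * c u y + t * c u x := by fun_prop
      exact (hcont.continuousAt.eventually_mem (x := 0) (s := Set.Ioi 0)
        (isOpen_Ioi.mem_nhds (by simpa using (hyc S c hc hTS).1 u huT))).filter_mono
        nhdsWithin_le_nhds
    · have hpos : 0 < c u x := by
        refine lt_of_le_of_ne (not_lt.1 fun h => huT (hG ?_)) (coord_ne_zero hK hd hx hS hc hu).symm
        exact (mem_visibleOpp_iff hK hd hx hS hc hu).2 h
      filter_upwards [self_mem_nhdsWithin] with t ht
      rcases (hyc S c hc hTS).2 u hu huT with h | rfl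
      · rw [AffineMap.lineMap_real_apply, h, mul_zero, zero_add]
        exact mul_pos ht hpos
      · simpa using hpos
  -- Conversely, a simplex meeting the path arbitrarily near its start is of the required kind.
  have hB : ∀ S ∈ K.faces,
      (∃ᶠ t in 𝓝[>] (0 : ℝ), AffineMap.lineMap y x t ∈ convexHull ℝ (S : Set E)) →
      S ∈ topSimplices K d ∧ visibleOpp x S ⊆ T ∧ T ⊆ S := by
    intro S hS hfr
    have hyS' : y ∈ convexHull ℝ (S : Set E) := by
      refine (S.finite_toSet.isClosed_convexHull ℝ).mem_of_frequently_of_tendsto hfr ?_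
      have hcont : Continuous fun t : ℝ => AffineMap.lineMap y x t := AffineMap.lineMap_continuous
      simpa using (hcont.tendsto 0).mono_left nhdsWithin_le_nhds
    obtain ⟨t, htS, ht0⟩ := (hfr.and_eventually self_mem_nhdsWithin).exists
    have ht0' : (0 : ℝ) < t := ht0
    have hxS : x ∈ affineSpan ℝ (S : Set E) := by
      have h := AffineMap.lineMap_mem t⁻¹ (convexHull_subset_affineSpan _ hyS')
        (convexHull_subset_affineSpan _ htS)
      rwa [AffineMap.lineMap_lineMap_right, inv_mul_cancel₀ ht0'.ne',
        AffineMap.lineMap_apply_one] at h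
    have hStop : S ∈ topSimplices K d := by
      refine ⟨hS, le_antisymm (card_le_of_mem_faces hK hd hS) (not_lt.1 fun h => ?_)⟩
      exact hx.2 S hS h hxS
    have hTS := hyS S hS hyS'
    refine ⟨hStop, fun u hu => ?_, hTS⟩
    obtain ⟨c, hc⟩ := exists_isBaryCoord (K.indep hS)
    have huS : u ∈ S := visibleOpp_subset x S hu
    by_contra huT
    -- The coordinate at `u` is `0` at `y` (or `y = x`) and nonnegative a little further on the path.
    have hneg := (mem_visibleOpp_iff hK hd hx hStop hc huS).1 hu
    have h := hc.nonneg htS huS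
    rcases (hyc S c hc hTS).2 u huS huT with h0 | rfl
    · rw [AffineMap.lineMap_real_apply, h0] at h
      nlinarith
    · rw [AffineMap.lineMap_same_apply] at h
      linarith
  have hex : ∃ S ∈ K.faces,
      ∃ᶠ t in 𝓝[>] (0 : ℝ), AffineMap.lineMap y x t ∈ convexHull ℝ (S : Set E) := by
    by_contra! hno
    have hno' : ∀ᶠ t in 𝓝[>] (0 : ℝ), ∀ S ∈ K.faces,
        AffineMap.lineMap y x t ∉ convexHull ℝ (S : Set E) :=
      (Filter.eventually_all_finite hfin).2 hno
    obtain ⟨t, ⟨ht, ht0⟩, ht1⟩ := ((hno'.and self_mem_nhdsWithin).and hlt).exists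
    have hzP := hconv.lineMap_mem hyP hx.1 ⟨le_of_lt ht0, ht1.le⟩
    rw [← hK, Geometry.SimplicialComplex.mem_space_iff] at hzP
    obtain ⟨S, hS, hzS⟩ := hzP
    exact ht S hS hzS
  obtain ⟨S, hS, hfr⟩ := hex
  refine ⟨S, hB S hS hfr, fun S' ⟨hS', hG', hTS'⟩ => ?_⟩
  obtain ⟨c, hc⟩ := exists_isBaryCoord (K.indep hS'.1)
  obtain ⟨t, ⟨htS, htpos⟩, ht0, ht1⟩ := ((hfr.and_eventually (hA S' hS' hG' hTS' c hc)).and_eventually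
    (Filter.Eventually.and self_mem_nhdsWithin hlt)).exists
  have hzP := hconv.lineMap_mem hyP hx.1 ⟨le_of_lt ht0, ht1.le⟩
  exact eq_of_coord_pos_of_mem hS' (hB S hS hfr).1 hc
    (hc.mem_convexHull (mem_affineSpan_of_mem_topSimplices hK hd hS' hzP)
      fun u hu => (htpos u hu).le) htpos htS

end Decomposition

/-! ### The `h`-vector and the `k`-vector -/

theorem card_nonvisibleOpp_add_card_visibleOpp (x : E) (F : Finset E) :
    (nonvisibleOpp x F).card + (visibleOpp x F).card = F.card := by
  classical
  have h : nonvisibleOpp x F = F \ visibleOpp x F := by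
    ext u
    simp only [nonvisibleOpp, visibleOpp, nonvisibleFacets, Finset.mem_filter, Finset.mem_sdiff,
      Set.mem_sdiff]
    refine ⟨fun ⟨hu, _, hv⟩ => ⟨hu, fun h => hv h.2⟩, fun ⟨hu, hv⟩ => ⟨hu, ⟨?_, ?_⟩,
      fun h => hv ⟨hu, h⟩⟩⟩
    · exact Finset.erase_subset u F
    · exact Finset.card_erase_add_one hu
  rw [h, Finset.card_sdiff_add_card_eq_card (visibleOpp_subset x F)]

/-- Counting the simplices with `i` vertices by the pieces of the half-open decomposition. -/
theorem faceCount_eq_sum [FiniteDimensional ℝ E] {K : Geometry.SimplicialComplex ℝ E} {P : Set E}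
    {d : ℕ} {x : E} (hfin : K.faces.Finite) (hK : K.space = P) (hconv : Convex ℝ P)
    (hd : Module.finrank ℝ (vectorSpan ℝ P) = d) (hx : IsInGeneralPosition K d P x)
    {Top : Finset (Finset E)} (hTop : (Top : Set (Finset E)) = topSimplices K d) (i : ℕ) :
    faceCount K i = ∑ F ∈ Top, if (visibleOpp x F).card ≤ i then
      (d + 1 - (visibleOpp x F).card).choose (i - (visibleOpp x F).card) else 0 := by
  classical
  have hmem : ∀ F, F ∈ Top ↔ F ∈ topSimplices K d := fun F => by rw [← hTop, Finset.mem_coe]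
  have hset : {S : Finset E | (S = ∅ ∨ S ∈ K.faces) ∧ S.card = i} =
      (Top.biUnion fun F => {T ∈ F.powersetCard i | visibleOpp x F ⊆ T} : Finset (Finset E)) := by
    ext T
    simp only [Set.mem_ofPred_eq, Finset.coe_biUnion, Set.mem_iUnion, Finset.mem_coe,
      Finset.mem_filter, Finset.mem_powersetCard, exists_prop]
    constructor
    · rintro ⟨hT, hcard⟩
      obtain ⟨F, ⟨hF, hG, hTF⟩, -⟩ := existsUnique_visibleOpp_subset hfin hK hconv hd hx hT
      exact ⟨F, (hmem F).2 hF, ⟨hTF, hcard⟩, hG⟩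
    · rintro ⟨F, hF, ⟨hTF, hcard⟩, -⟩
      exact ⟨T.eq_empty_or_nonempty.imp_right fun h => K.down_closed ((hmem F).1 hF).1 hTF h, hcard⟩
  rw [faceCount, hset, Set.ncard_coe_finset, Finset.card_biUnion]
  · refine Finset.sum_congr rfl fun F hF => ?_
    rw [card_filter_subset_powersetCard (visibleOpp_subset x F), ((hmem F).1 hF).2]
  · intro F hF F' hF' hne
    refine Finset.disjoint_left.2 fun T hT hT' => hne ?_
    simp only [Finset.mem_filter, Finset.mem_powersetCard] at hT hT'
    have hTK : T = ∅ ∨ T ∈ K.faces :=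
      T.eq_empty_or_nonempty.imp_right fun h => K.down_closed ((hmem F).1 hF).1 hT.1.1 h
    exact (existsUnique_visibleOpp_subset hfin hK hconv hd hx hTK).unique
      ⟨(hmem F).1 hF, hT.2, hT.1.1⟩ ⟨(hmem F').1 hF', hT'.2, hT'.1.1⟩

/-- The entry `h_j` counts the top-dimensional simplices with exactly `j` visible facets. -/
theorem hVec_eq_card [FiniteDimensional ℝ E] {K : Geometry.SimplicialComplex ℝ E} {P : Set E}
    {d : ℕ} {x : E} (hfin : K.faces.Finite) (hK : K.space = P) (hconv : Convex ℝ P)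
    (hd : Module.finrank ℝ (vectorSpan ℝ P) = d) (hx : IsInGeneralPosition K d P x)
    {Top : Finset (Finset E)} (hTop : (Top : Set (Finset E)) = topSimplices K d) {j : ℕ}
    (hj : j ≤ d + 1) : hVec K d j = ({F ∈ Top | (visibleOpp x F).card = j} : Finset _).card := by
  simp only [hVec, faceCount_eq_sum hfin hK hconv hd hx hTop, Nat.cast_sum, Finset.mul_sum]
  rw [Finset.sum_comm, Finset.sum_congr rfl fun F _ => sum_alternating_choose_eq_ite hj,
    Finset.sum_boole]

theorem mainTheorem4 (n d : ℕ) (P : Set (EuclideanSpace ℝ (Fin n))) (hP : IsPolytope d P)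
    (K : Geometry.SimplicialComplex ℝ (EuclideanSpace ℝ (Fin n)))
    (hK : IsPointedTriangulation K P)
    (x : EuclideanSpace ℝ (Fin n)) (hx : IsInGeneralPosition K d P x) :
    (∀ F ∈ topSimplices K d, (nonvisibleOpp x F).card + (visibleOpp x F).card = d + 1) ∧
      ∀ i ≤ d + 1, (kVec K d x i : ℤ) = hVec K d (d + 1 - i) := by
  have hcard : ∀ F ∈ topSimplices K d,
      (nonvisibleOpp x F).card + (visibleOpp x F).card = d + 1 :=
    fun F hF => (card_nonvisibleOpp_add_card_visibleOpp x F).trans hF.2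
  refine ⟨hcard, fun i hi => ?_⟩
  obtain ⟨⟨V, -, hV⟩, hd⟩ := hP
  obtain ⟨C, v, rfl, htri, -⟩ := hK
  obtain ⟨hfin, hspace⟩ := htri P ⟨⟨x, hx.1⟩, IsExposed.refl P⟩
  have hTopfin : (topSimplices (C P) d).Finite := hfin.subset fun _ h => h.1
  rw [hVec_eq_card hfin hspace (hV ▸ convex_convexHull ℝ _) hd hx hTopfin.coe_toFinset
    (Nat.sub_le _ _), kVec, ← Set.ncard_coe_finset]
  congr 2
  ext F
  simp only [Finset.coe_filter, Set.Finite.mem_toFinset, Set.mem_ofPred_eq]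
  refine and_congr_right fun hF => ?_
  have := hcard F hF
  omega
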